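/- Let $S^2(\mathbb{C}^n)$ be the space of symmetric complex $n\times n$ matrices with coordinates $x_{i,j}$, $i\le j$. For $n\ge 3$ let $L_{C_n}\subset S^2(\mathbb{C}^n)$ be the space of symmetric matrices whose entry $(i,j)$ is zero whenever $i\ne j$ and $\{i,j\}$ is not an edge of the $n$-cycle $C_n$. Let $L_{C_n}^{-1}\subset S^2(\mathbb{C}^n)$ be the Zariski closure of $\{K^{-1} : K\in L_{C_n},\ \det K\neq 0\}$, and let $L_{C_n}^{\perp}\subset S^2(\mathbb{C}^n)$ be the orthogonal complement of $L_{C_n}$ for the trace pairing, so that $\mathrm{Id}+L_{C_n}^\perp$ is the set of symmetric matrices with diagonal entries $1$ and with zero entries at the edges of $C_n$. Let $M_n(x)$ be the $n\times n$ tridiagonal matrix with $1$ on the diagonal and $x$ on the two adjacent diagonals, and let $M_n^{\pm}(x)$ be obtained from $M_n(x)$ by replacing the two corner entries $(1,n)$ and $(n,1)$ by $\pm x$. Put $P_k(x)=\det M_k(x)$ for $k\ge 0$ (so $P_0=P_1=1$). Let $\mathcal{D}_n^{\pm}$ be the group of diagonal $n\times n$ matrices with diagonal entries $\pm1$. Call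 a point $A$ of $L_{C_n}^{-1}\cap(\mathrm{Id}+L_{C_n}^{\perp})$ a *smooth isolated point of the intersection* if the Jacobian matrix at $A$ of the ideal $I(L_{C_n}^{-1})+I(\mathrm{Id}+L_{C_n}^{\perp})\subset\mathbb{C}[x_{i,j}]$ has full rank $\binom{n+1}{2}$, i.e. the gradients at $A$ of the elements of this ideal span the whole space. **Proposition.** Let $z\in\mathbb{C}$. 1. If $m\ge 2$ and $P_{m-1}(z)+zP_{m-2}(z)=0$, then $M_{2m+1}^{+}(z)$ is invertible and, for every $D\in\mathcal{D}_{2m+1}^{\pm}$, the matrix $D\,M_{2m+1}^{+}(z)^{-1}D$ is a smooth isolated point of the intersection $L_{C_{2m+1}}^{-1}\cap(\mathrm{Id}+L_{C_{2m+1}}^{\perp})$. 2. If $m\ge 3$ and $P_{m-1}(z)-z^2P_{m-3}(z)=0$, then $M_{2m}^{+}(z)$ is invertible and, for every $D\in\mathcal{D}_{2m}^{\pm}$, the matrix $D\,M_{2m}^{+}(z)^{-1}D$ is a smooth isolated point of the intersection $L_{C_{2m}}^{-1}\cap(\mathrm{Id}+L_{C_{2m}}^{\perp})$. 3. If $m\ge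 2$ and $P_{m-2}(z)=0$, then $M_{2m}^{-}(z)$ is invertible and, for every $D\in\mathcal{D}_{2m}^{\pm}$, the matrix $D\,M_{2m}^{-}(z)^{-1}D$ is a smooth isolated point of the intersection $L_{C_{2m}}^{-1}\cap(\mathrm{Id}+L_{C_{2m}}^{\perp})$. -/

import Mathlib

namespace CycleModel

/-- Index set of the coordinates `x_{i,j}`, `i ≤ j`, on the space `S²(ℂⁿ)` of symmetric
`n × n` matrices. -/
abbrev SymIdx (n : ℕ) : Type := {p : Fin n × Fin n // p.1 ≤ p.2}

/-- The coordinate vector `(x_{i,j})_{i ≤ j}` of a (symmetric) matrix. -/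
def symCoord {n : ℕ} (A : Matrix (Fin n) (Fin n) ℂ) : SymIdx n → ℂ :=
  fun p => A p.1.1 p.1.2

/-- `L_Γ`: the symmetric complex matrices whose entry `(i, j)` vanishes whenever `i ≠ j` and
`{i, j}` is not an edge of `Γ`. -/
def graphSpace {n : ℕ} (G : SimpleGraph (Fin n)) : Set (Matrix (Fin n) (Fin n) ℂ) :=
  {K | K.IsSymm ∧ ∀ i j, i ≠ j → ¬ G.Adj i j → K i j = 0}

/-- `Λ^⊥`: the symmetric matrices orthogonal to all of `Λ` for the trace pairing. -/
def symPerp {n : ℕ} (L : Set (Matrix (Fin n) (Fin n) ℂ)) : Set (Matrix (Fin n) (Fin n) ℂ) :=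
  {X | X.IsSymm ∧ ∀ K ∈ L, (X * K).trace = 0}

/-- `Λ⁻¹`: the Zariski closure, in the affine space `S²(ℂⁿ)`, of the set of inverses of the
invertible elements of `Λ`. -/
def reciprocalVariety {n : ℕ} (L : Set (Matrix (Fin n) (Fin n) ℂ)) : Set (SymIdx n → ℂ) :=
  MvPolynomial.zeroLocus ℂ (MvPolynomial.vanishingIdeal ℂ
    (symCoord '' {A | ∃ K ∈ L, IsUnit K.det ∧ A = K⁻¹}))

/-- The affine space `Id + Λ^⊥`. -/
def identityFiber {n : ℕ} (L : Set (Matrix (Fin n) (Fin n) ℂ)) : Set (SymIdx n → ℂ) :=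
  symCoord '' {A | ∃ X ∈ symPerp L, A = 1 + X}

/-- The row space `𝕋(p)` of the Jacobian matrix at `p` of (the elements of) an ideal: the span of
all gradients `(∂f/∂x_s (p))_s`. At a zero `p` of the ideal any generating set gives the same
space. -/
def jacobianRowSpace {σ : Type*} (I : Ideal (MvPolynomial σ ℂ)) (p : σ → ℂ) :
    Submodule ℂ (σ → ℂ) :=
  Submodule.span ℂ
    ((fun f : MvPolynomial σ ℂ => fun s => MvPolynomial.eval p (MvPolynomial.pderiv s f)) ''
      (I : Set (MvPolynomial σ ℂ)))

/-- `p` is a smooth (equivalently, reduced) isolated point of the scheme-theoretic intersection of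
the affine varieties `X` and `Y`: it lies on both, and the Jacobian matrix at `p` of the ideal
`I(X) + I(Y)` of the intersection has full rank, equal to the number of variables. -/
def IsSmoothIsolatedPointOfInter {σ : Type*} (X Y : Set (σ → ℂ)) (p : σ → ℂ) : Prop :=
  p ∈ X ∩ Y ∧
    jacobianRowSpace (MvPolynomial.vanishingIdeal ℂ X ⊔ MvPolynomial.vanishingIdeal ℂ Y) p = ⊤

/-- `L_{C_n}` for the `n`-cycle `C_n`. -/
def cycleSpace (n : ℕ) : Set (Matrix (Fin n) (Fin n) ℂ) :=
  graphSpace (SimpleGraph.cycleGraph n)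

/-- `A` is a smooth isolated point of `L_{C_n}⁻¹ ∩ (Id + L_{C_n}^⊥)`. -/
def IsSmoothInIntersection {n : ℕ} (A : Matrix (Fin n) (Fin n) ℂ) : Prop :=
  A.IsSymm ∧
    IsSmoothIsolatedPointOfInter (reciprocalVariety (cycleSpace n)) (identityFiber (cycleSpace n))
      (symCoord A)

/-- The tridiagonal matrix `M_n(x)`: ones on the diagonal and `x` next to it. -/
def pathMatrix (n : ℕ) (x : ℂ) : Matrix (Fin n) (Fin n) ℂ :=
  Matrix.of fun i j =>
    if i = j then 1
    else if (i : ℕ) + 1 = j ∨ (j : ℕ) + 1 = i then x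
    else 0

/-- `M_n(x)` with both corner entries `(1, n)` and `(n, 1)` replaced by `c` (for `n ≥ 3`). -/
def cornerMatrix (n : ℕ) (x c : ℂ) : Matrix (Fin n) (Fin n) ℂ :=
  Matrix.of fun i j =>
    if ((i : ℕ) = 0 ∧ (j : ℕ) + 1 = n) ∨ ((j : ℕ) = 0 ∧ (i : ℕ) + 1 = n) then c
    else pathMatrix n x i j

/-- `M_n⁺(x)`. -/
def Mplus (n : ℕ) (x : ℂ) : Matrix (Fin n) (Fin n) ℂ := cornerMatrix n x x

/-- `M_n⁻(x)`. -/
def Mminus (n : ℕ) (x : ℂ) : Matrix (Fin n) (Fin n) ℂ := cornerMatrix n x (-x)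

/-- `P_n(x) = det M_n(x)`; in particular `P_0 = P_1 = 1`. -/
noncomputable def P (n : ℕ) (x : ℂ) : ℂ := (pathMatrix n x).det

/-- The group of diagonal `n × n` matrices with diagonal entries `±1`. -/
def signMatrices (n : ℕ) : Set (Matrix (Fin n) (Fin n) ℂ) :=
  {D | ∃ d : Fin n → ℂ, (∀ i, d i = 1 ∨ d i = -1) ∧ D = Matrix.diagonal d}

end CycleModel

/-! Write z = -1/(q + q⁻¹) and let σ = ±1 be the sign of the corner entries. Then `P k z` is a
Chebyshev-type expression in q (`P_mul_sub_inv`), and each hypothesis on z yields q² ≠ 1 and q^(n-2)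
= -σ. The corner matrix K is the operator L = 1 + z(S + S⁻¹), S the shift, on sequences with x(k+n)
= σ x(k). The solution u = `sineSeq q` of Lu = 0 satisfies u(n-2-k) = σ u(k), so -u(|i-j|-1) is the
Green's function of L (`cornerMatrix_mul_sineMatrix`). It is 1 on the diagonal, and 0 at the edges
because u(0) = u(n-2) = 0.

For smoothness, let H be a direction killed by all differentials. It vanishes on the diagonal and
the edges. The non-edge entries of the adjugate vanish on the reciprocal variety, and
differentiating adj(X) X = det(X) at K⁻¹ shows that KHK vanishes at the non-edges
(`isSmoothIsolated_inv`). Lifted to ℤ × ℤ, this forces each column of HL to be a multiple of u;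
symmetry and quasi-periodicity make the multiple a single constant c. Rows of H then solve the
resonant equation Lh = cu with zero data at both ends of a period, and the solvability condition
reads c(n-2) = 0 (`kernel_eq_zero`). Conjugation by a sign matrix preserves the whole problem. -/

namespace CycleModel

/-! ### Sine sequences and the three-term recurrence -/

/-- The solution `u` of `u (k-1) + u (k+1) = (q + q⁻¹) u k` with `u 0 = 0` and `u 1 = 1`. -/
noncomputable def sineSeq (q : ℂ) (k : ℤ) : ℂ := (q ^ k - q ^ (-k)) / (q - q⁻¹)

theorem sub_inv_ne_zero {q : ℂ} (hq : q ≠ 0) (hq2 : q ^ 2 ≠ 1) : q - q⁻¹ ≠ 0 := by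
  intro h
  apply hq2
  field_simp at h
  linear_combination h

theorem sineSeq_zero (q : ℂ) : sineSeq q 0 = 0 := by simp [sineSeq]

theorem sineSeq_one {q : ℂ} (hq : q ≠ 0) (hq2 : q ^ 2 ≠ 1) : sineSeq q 1 = 1 := by
  have := sub_inv_ne_zero hq hq2
  simp only [sineSeq, zpow_one, zpow_neg]
  exact div_self this

theorem sineSeq_neg (q : ℂ) (k : ℤ) : sineSeq q (-k) = -sineSeq q k := by
  simp only [sineSeq, neg_neg]
  ring

theorem sineSeq_rec {q z : ℂ} (hq : q ≠ 0) (hz : z * (q + q⁻¹) = -1) (k : ℤ) :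
    sineSeq q k + z * (sineSeq q (k - 1) + sineSeq q (k + 1)) = 0 := by
  have e1 : q ^ (-(k - 1)) = q ^ (-k) * q := by
    rw [← zpow_add_one₀ hq]; congr 1; ring
  have e2 : q ^ (-(k + 1)) = q ^ (-k) * q⁻¹ := by
    rw [← zpow_sub_one₀ hq]; congr 1; ring
  simp only [sineSeq, zpow_sub_one₀ hq k, zpow_add_one₀ hq k, e1, e2]
  linear_combination ((q ^ k - q ^ (-k)) / (q - q⁻¹)) * hz

theorem zpow_neg_eq_of_eq_neg {q σ : ℂ} (hσ : σ * σ = 1) {N : ℤ} (hN : q ^ N = -σ) :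
    q ^ (-N) = -σ := by
  rw [zpow_neg, hN]
  exact inv_eq_of_mul_eq_one_left (by linear_combination hσ)

theorem sineSeq_add {q σ : ℂ} (hq : q ≠ 0) (hσ : σ * σ = 1) {N : ℤ} (hN : q ^ N = -σ) (k : ℤ) :
    sineSeq q (k + N) = -σ * sineSeq q k := by
  simp only [sineSeq, neg_add, zpow_add₀ hq, hN, zpow_neg_eq_of_eq_neg hσ hN]
  ring

/-- Solutions of the three-term recurrence are determined by two consecutive values. -/
theorem eq_sineSeq_of_rec {q z : ℂ} (hq : q ≠ 0) (hq2 : q ^ 2 ≠ 1) (hz : z * (q + q⁻¹) = -1)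
    (g : ℤ → ℂ) (N : ℤ)
    (hg : ∀ k : ℤ, 1 ≤ k → k < N → g k + z * (g (k - 1) + g (k + 1)) = 0) (k : ℕ) :
    (k : ℤ) + 1 ≤ N → g k = g 1 * sineSeq q k - g 0 * sineSeq q (k - 1) ∧
      g (k + 1) = g 1 * sineSeq q (k + 1) - g 0 * sineSeq q k := by
  have hz0 : z ≠ 0 := by rintro rfl; simp at hz
  induction k with
  | zero =>
    intro _
    have h1 : sineSeq q (-1) = -1 := by rw [sineSeq_neg, sineSeq_one hq hq2]
    simp [sineSeq_zero, sineSeq_one hq hq2, h1]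
  | succ k ih =>
    intro hk
    push_cast at hk ⊢
    obtain ⟨h1, h2⟩ := ih (by linarith)
    have r := hg (k + 1) (by omega) (by omega)
    have s1 := sineSeq_rec hq hz (k + 1)
    have s0 := sineSeq_rec hq hz k
    rw [add_sub_cancel_right] at r s1 ⊢
    refine ⟨h2, mul_left_cancel₀ hz0 ?_⟩
    linear_combination r - g 1 * s1 + g 0 * s0 - h2 - z * h1

theorem sum_sq_pow_eq_zero {q σ : ℂ} (hq2 : q ^ 2 ≠ 1) (hσ : σ * σ = 1) {N : ℕ}
    (hN : q ^ N = -σ) : ∑ k ∈ Finset.range N, (q ^ 2) ^ k = 0 := by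
  rw [geom_sum_eq hq2, ← pow_mul, mul_comm, pow_mul, hN]
  simp [pow_two, hσ]

/-! ### Rigidity of the linearized problem -/

/-- A symmetric `σ`-periodic kernel vanishing on the diagonal and next to it, and annihilated by
`(1 + z (S + S⁻¹)) ⊗ (1 + z (S + S⁻¹))` away from these places, is zero. -/
theorem kernel_eq_zero {n : ℕ} (hn : 4 ≤ n) {q z σ : ℂ} (hq : q ≠ 0) (hq2 : q ^ 2 ≠ 1)
    (hz : z * (q + q⁻¹) = -1) (hσ : σ * σ = 1) (hqn : q ^ (n - 2) = -σ)
    (H G : ℤ → ℤ → ℂ) (symm : ∀ i j, H i j = H j i) (per : ∀ i j, H (i + n) j = σ * H i j)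
    (h0 : ∀ i, H i i = 0) (h1 : ∀ i, H i (i + 1) = 0)
    (hG : ∀ i j, G i j = H i j + z * (H i (j - 1) + H i (j + 1)))
    (hK : ∀ i j : ℤ, 2 ≤ j - i → j - i ≤ n - 2 → G i j + z * (G (i - 1) j + G (i + 1) j) = 0)
    (i j : ℤ) : H i j = 0 := by
  have hz0 : z ≠ 0 := by rintro rfl; simp at hz
  have hσ0 : σ ≠ 0 := by rintro rfl; simp at hσ
  obtain ⟨N, rfl⟩ : ∃ N, n = N + 2 := ⟨n - 2, by omega⟩
  rw [Nat.add_sub_cancel] at hqn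
  have hqz : q ^ (N : ℤ) = -σ := by rw [zpow_natCast, hqn]
  push_cast at per hK
  have u1 := sineSeq_one hq hq2
  have un1 : sineSeq q (-1) = -1 := by rw [sineSeq_neg, u1]
  have uN (k : ℤ) := sineSeq_add hq hσ hqz k
  have uN0 : sineSeq q N = 0 := by simpa [sineSeq_zero] using uN 0
  have uN1 : sineSeq q (N - 1) = σ := by
    have := uN (-1)
    rw [un1] at this
    rw [show (N : ℤ) - 1 = -1 + N by ring, this]; ring
  have h1' (i : ℤ) : H (i + 1) i = 0 := by rw [symm, h1]
  -- Moving away from the diagonal in column j, G solves the homogeneous recurrence across a whole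
  -- period.
  have col (j : ℤ) (k : ℕ) (hk : (k : ℤ) ≤ N) :
      G (j - 1 - k) j = G (j - 2) j * sineSeq q k - G (j - 1) j * sineSeq q (k - 1) := by
    have key := eq_sineSeq_of_rec hq hq2 hz (fun l : ℤ => G (j - 1 - l) j) N (by
      intro k hk1 hk2
      have := hK (j - 1 - k) j (by omega) (by omega)
      rw [show j - 1 - (k - 1) = j - 1 - k + 1 by ring,
        show j - 1 - (k + 1) = j - 1 - k - 1 by ring]
      linear_combination this)
    beta_reduce at key
    rw [sub_zero, show j - 1 - 1 = j - 2 by ring] at key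
    rcases k with _ | k
    · simpa using (key 0 (by omega)).1
    · have := (key k (by push_cast at hk; omega)).2
      push_cast
      rw [add_sub_cancel_right]
      exact this
  -- At k = N the column formula gives G(j-1-N, j) = -σ G(j-1, j). Quasi-periodicity and symmetry
  -- identify the two sides with σzH(j-1, j+1) and its negative.
  have h2 (j : ℤ) : H (j - 1) (j + 1) = 0 := by
    have e1 := col j N le_rfl
    have e2 := hG (j - 1 - N) j
    have e3 := hG (j - 1) j
    have p1 := per (j - 1 - N) j
    have p2 := per (j - 1 - N) (j - 1)
    have p3 := per (j - 1 - N) (j + 1)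
    rw [show j - 1 - (N : ℤ) + (N + 2) = j + 1 by ring] at p1 p2 p3
    rw [h1'] at p1
    rw [h0] at p3
    rw [symm (j + 1)] at p2
    have q3 : H (j - 1) j = 0 := by simpa using h1 (j - 1)
    rw [h0, q3] at e3
    have z1 : H (j - 1 - N) j = 0 := by simpa [hσ0] using p1.symm
    have z3 : H (j - 1 - N) (j + 1) = 0 := by simpa [hσ0] using p3.symm
    rw [z1, z3] at e2
    rw [uN0, uN1] at e1
    have : z * H (j - 1) (j + 1) = 0 := by
      linear_combination (1 / 2 : ℂ) * z * p2 + (1/2 : ℂ) * σ * (e1 - e2 - σ * e3)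
        + (1 / 2 : ℂ) * z * H (j - 1) (j + 1) * (-hσ)
    simpa [hz0] using this
  have hG1 (j : ℤ) : G (j - 1) j = 0 := by
    have q3 : H (j - 1) j = 0 := by simpa using h1 (j - 1)
    rw [hG, h0, h2, q3]; ring
  have hG2 (j : ℤ) : G (j - 2) j = z * H (j - 2) (j + 1) := by
    have q1 := h2 (j - 1)
    have q2 := h1 (j - 2)
    rw [sub_add_cancel, show j - 1 - 1 = j - 2 by ring] at q1
    rw [show j - 2 + 1 = j - 1 by ring] at q2
    rw [hG, q1, q2]; ring
  have col' (j : ℤ) (k : ℕ) (hk : (k : ℤ) ≤ N) :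
      G (j - 1 - k) j = G (j - 2) j * sineSeq q k := by
    rw [col j k hk, hG1]; ring
  -- The same wrap-around comparison one step earlier, at k = N - 1: G(j-N, j) is σ times the
  -- coefficient of column j and also of column j + 1.
  have cstep (j : ℤ) : G (j - 2) j = G (j + 1 - 2) (j + 1) := by
    have e1 := col' j (N - 1) (by omega)
    rw [Nat.cast_sub (by omega), Nat.cast_one, uN1] at e1
    have e2 := hG2 (j + 1)
    have e3 := hG (j - 1 - (N - 1)) j
    have p1 := per (j - 1 - (N - 1)) j
    have p2 := per (j - 1 - (N - 1)) (j - 1)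
    have p3 := per (j - 1 - (N - 1)) (j + 1)
    rw [show j - 1 - ((N : ℤ) - 1) + (N + 2) = j + 2 by ring] at p1 p2 p3
    have q1 := h2 (j + 1)
    rw [add_sub_cancel_right, show j + 1 + 1 = j + 2 by ring, symm] at q1
    have q2 := h1' (j + 1)
    rw [show j + 1 + 1 = j + 2 by ring] at q2
    rw [q1] at p1
    rw [q2] at p3
    rw [symm (j + 2)] at p2
    have z1 : H (j - 1 - (N - 1)) j = 0 := by simpa [hσ0] using p1.symm
    have z3 : H (j - 1 - (N - 1)) (j + 1) = 0 := by simpa [hσ0] using p3.symm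
    rw [z1, z3] at e3
    rw [show j + 1 - 2 = j - 1 by ring, show j + 1 + 1 = j + 2 by ring] at e2
    rw [show j + 1 - 2 = j - 1 by ring]
    linear_combination σ * (e3 - e1) - z * p2 - e2
      - G (j - 2) j * hσ
  have cconst (j : ℤ) : G (j - 2) j = G (0 - 2) 0 := by
    induction j using Int.induction_on with
    | zero => rfl
    | succ k ih => rw [← cstep, ih]
    | pred k ih =>
      rw [← ih]
      have := cstep (-k - 1)
      rw [sub_add_cancel] at this
      exact this
  set c := G (0 - 2) 0 with hc
  have row (i : ℤ) (k : ℕ) (hk : (k : ℤ) ≤ N) :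
      H i (i + 1 + k) + z * (H i (i + k) + H i (i + 2 + k)) = c * sineSeq q k := by
    have := col' (i + 1 + k) k hk
    rw [cconst, hG] at this
    rw [← this, show i + 1 + (k : ℤ) - 1 - k = i by ring, show i + 1 + (k : ℤ) - 1 = i + k by ring,
      show i + 1 + (k : ℤ) + 1 = i + 2 + k by ring]
  -- Multiplying the row equation by the homogeneous solution q^(k+1) makes its left side a
  -- difference of consecutive terms.
  have telescope (i : ℤ) (k : ℕ) : (k : ℤ) ≤ N + 1 →
      z * (q ^ k * H i (i + k + 1) - q ^ (k + 1) * H i (i + k)) =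
        c / (q - q⁻¹) * ∑ l ∈ Finset.range k, ((q ^ 2) ^ l - 1) * q := by
    induction k with
    | zero => intro _; simp [h0, h1]
    | succ k ih =>
      intro hk
      push_cast at hk
      have hi := ih (by omega)
      have hr := row i k (by omega)
      rw [Finset.sum_range_succ, mul_add, ← hi]
      push_cast
      rw [show i + (k + 1 : ℤ) + 1 = i + 2 + k by ring, show i + (k + 1 : ℤ) = i + 1 + k by ring,
        show i + (k : ℤ) + 1 = i + 1 + k by ring]
      have e : c / (q - q⁻¹) * (((q ^ 2) ^ k - 1) * q) = q ^ (k + 1) * (c * sineSeq q k) := by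
        simp only [sineSeq, zpow_neg, zpow_natCast]
        field_simp
        ring
      have hz' : z * (q ^ 2 + 1) = -q := by field_simp at hz; linear_combination hz
      rw [e, ← hr]
      linear_combination (-q ^ k * H i (i + 1 + k)) * hz'
  -- Over a full period the boundary terms vanish, while the sum is -N q: the powers of q² cancel
  -- except the last, which equals 1, against N + 1 ones.
  have hc0 : c = 0 := by
    have t := telescope 0 (N + 1) (by push_cast; rfl)
    have p1 : H 0 (0 + ((N + 1 : ℕ) : ℤ) + 1) = 0 := by
      have := per 0 0
      rw [symm, show (0 : ℤ) + ((N + 1 : ℕ) : ℤ) + 1 = 0 + (N + 2) by push_cast; ring, this, h0,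
        mul_zero]
    have p2 : H 0 (0 + ((N + 1 : ℕ) : ℤ)) = 0 := by
      have := per (-1) 0
      have q1 := h1 (-1)
      rw [neg_add_cancel] at q1
      rw [symm, show (0 : ℤ) + ((N + 1 : ℕ) : ℤ) = -1 + (N + 2) by push_cast; ring, symm,
        symm, this, q1, mul_zero]
    rw [p1, p2, ← Finset.sum_mul, Finset.sum_range_succ, Finset.sum_sub_distrib,
      sum_sq_pow_eq_zero hq2 hσ hqn, ← pow_mul, mul_comm 2, pow_mul, hqn] at t
    have hN : (N : ℂ) ≠ 0 := by
      have : N ≠ 0 := by omega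
      exact_mod_cast this
    simp [pow_two, hσ, hq, hN, sub_inv_ne_zero hq hq2] at t
    exact t
  have zeroN (i : ℤ) (k : ℕ) : (k : ℤ) ≤ N + 1 → H i (i + k) = 0 ∧ H i (i + 1 + k) = 0 := by
    induction k with
    | zero => intro _; simp [h0, h1]
    | succ k ih =>
      intro hk
      push_cast at hk ⊢
      obtain ⟨a, b⟩ := ih (by omega)
      have hr := row i k (by omega)
      rw [a, b, hc0] at hr
      rw [show i + (k + 1 : ℤ) = i + 1 + k by ring, show i + 1 + (k + 1 : ℤ) = i + 2 + k by ring]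
      refine ⟨b, ?_⟩
      simpa [hz0] using hr
  have perr (i j : ℤ) : H i (j + (N + 2)) = σ * H i j := by rw [symm, per, symm]
  have shift (m : ℤ) (i j : ℤ) : H i (j + (N + 2) * m) = 0 → H i j = 0 := by
    induction m using Int.induction_on with
    | zero => simp
    | succ k ih =>
      intro h
      apply ih
      rw [mul_add, mul_one, ← add_assoc, perr] at h
      simpa [hσ0] using h
    | pred k ih =>
      intro h
      apply ih
      rw [show j + ((N : ℤ) + 2) * -k = j + (N + 2) * (-k - 1) + (N + 2) by ring, perr, h, mul_zero]
  apply shift (-((j - i) / (N + 2))) i j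
  have hm := Int.emod_add_mul_ediv (j - i) (N + 2)
  have hb1 := Int.emod_nonneg (j - i) (show (N + 2 : ℤ) ≠ 0 by omega)
  have hb2 := Int.emod_lt_of_pos (j - i) (show (0 : ℤ) < N + 2 by omega)
  have := (zeroN i ((j - i) % (N + 2)).toNat (by omega)).1
  rw [Int.toNat_of_nonneg hb1] at this
  rw [← this]
  congr 1
  linear_combination -hm


/-! ### Symmetric coordinates and the orthogonal complement -/

theorem mem_symPerp_graphSpace_iff {n : ℕ} {G : SimpleGraph (Fin n)}
    {X : Matrix (Fin n) (Fin n) ℂ} :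
    X ∈ symPerp (graphSpace G) ↔
      X.IsSymm ∧ (∀ i, X i i = 0) ∧ ∀ i j, G.Adj i j → X i j = 0 := by
  constructor
  · rintro ⟨hX, h⟩
    refine ⟨hX, fun i => ?_, fun i j hij => ?_⟩
    · have := h (Matrix.single i i 1) ⟨by simp [Matrix.IsSymm, Matrix.transpose_single], by
        intro a b hab _
        rw [Matrix.single_apply_of_ne]
        rintro ⟨rfl, rfl⟩
        exact hab rfl⟩
      simpa [Matrix.trace_mul_single] using this
    · have := h (Matrix.single i j 1 + Matrix.single j i 1)
        ⟨by simp [Matrix.IsSymm, Matrix.transpose_single, add_comm], by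
        intro a b _ hab
        rw [Matrix.add_apply, Matrix.single_apply_of_ne, Matrix.single_apply_of_ne, add_zero]
        · rintro ⟨rfl, rfl⟩
          exact hab hij.symm
        · rintro ⟨rfl, rfl⟩
          exact hab hij⟩
      rw [Matrix.mul_add, Matrix.trace_add, Matrix.trace_mul_single, Matrix.trace_mul_single,
        hX.apply] at this
      simpa using this
  · rintro ⟨hX, hd, he⟩
    refine ⟨hX, fun K hK => ?_⟩
    rw [Matrix.trace]
    refine Finset.sum_eq_zero fun i _ => ?_
    rw [Matrix.diag_apply, Matrix.mul_apply]
    refine Finset.sum_eq_zero fun j _ => ?_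
    by_cases hij : i = j
    · subst hij; rw [hd, zero_mul]
    · by_cases hG : G.Adj i j
      · rw [he i j hG, zero_mul]
      · rw [hK.2 j i (Ne.symm hij) (fun h => hG h.symm), mul_zero]

/-- The coordinate giving the entries `(i, j)` and `(j, i)` of a symmetric matrix. -/
def symIdx {n : ℕ} (i j : Fin n) : SymIdx n := ⟨(min i j, max i j), min_le_max⟩

/-- The symmetric matrix with a given coordinate vector. -/
def ofCoord {n : ℕ} {R : Type*} (v : SymIdx n → R) : Matrix (Fin n) (Fin n) R :=
  Matrix.of fun i j => v (symIdx i j)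

theorem ofCoord_isSymm {n : ℕ} {R : Type*} (v : SymIdx n → R) : (ofCoord v).IsSymm := by
  ext i j
  simp [ofCoord, symIdx, min_comm, max_comm]

theorem symCoord_symIdx {n : ℕ} {A : Matrix (Fin n) (Fin n) ℂ} (hA : A.IsSymm) (i j : Fin n) :
    symCoord A (symIdx i j) = A i j := by
  rcases le_total i j with h | h
  · simp [symCoord, symIdx, h]
  · simp [symCoord, symIdx, h, hA.apply]

theorem symIdx_self {n : ℕ} (p : SymIdx n) : symIdx p.1.1 p.1.2 = p := by
  rcases p with ⟨⟨i, j⟩, h⟩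
  simp only at h
  simp [symIdx, h]

/-- The generic symmetric matrix. -/
noncomputable def genericSym (n : ℕ) :
    Matrix (Fin n) (Fin n) (MvPolynomial (SymIdx n) ℂ) := ofCoord MvPolynomial.X

theorem genericSym_map_eval {n : ℕ} {A : Matrix (Fin n) (Fin n) ℂ} (hA : A.IsSymm) :
    (MvPolynomial.eval (symCoord A)).mapMatrix (genericSym n) = A := by
  ext i j
  simp [genericSym, ofCoord, symCoord_symIdx hA]

theorem eval_adjugate_genericSym {n : ℕ} {A : Matrix (Fin n) (Fin n) ℂ} (hA : A.IsSymm) :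
    (MvPolynomial.eval (symCoord A)).mapMatrix (genericSym n).adjugate = A.adjugate := by
  rw [RingHom.map_adjugate, genericSym_map_eval hA]

/-! ### Directional derivatives and the Jacobian criterion -/

/-- The derivative of a polynomial at `p` in the direction `v`. -/
noncomputable def dirDeriv {σ : Type*} [Fintype σ] (p v : σ → ℂ) (f : MvPolynomial σ ℂ) : ℂ :=
  ∑ s, v s * MvPolynomial.eval p (MvPolynomial.pderiv s f)

section dirDeriv

variable {σ : Type*} [Fintype σ] (p v : σ → ℂ)

theorem dirDeriv_X (s : σ) : dirDeriv p v (MvPolynomial.X s) = v s := by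
  classical
  simp [dirDeriv, MvPolynomial.pderiv_X, Pi.single_apply, apply_ite]

theorem dirDeriv_mul (f g : MvPolynomial σ ℂ) :
    dirDeriv p v (f * g) =
      MvPolynomial.eval p f * dirDeriv p v g + dirDeriv p v f * MvPolynomial.eval p g := by
  simp only [dirDeriv, Finset.mul_sum, Finset.sum_mul, ← Finset.sum_add_distrib]
  refine Finset.sum_congr rfl fun s _ => ?_
  simp only [Derivation.leibniz, smul_eq_mul, map_add, map_mul]
  ring

theorem dirDeriv_sum {ι : Type*} (t : Finset ι) (f : ι → MvPolynomial σ ℂ) :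
    dirDeriv p v (∑ i ∈ t, f i) = ∑ i ∈ t, dirDeriv p v (f i) := by
  simp only [dirDeriv, map_sum, Finset.mul_sum]
  exact Finset.sum_comm

theorem dirDeriv_matrix_mul {n : ℕ} (M N : Matrix (Fin n) (Fin n) (MvPolynomial σ ℂ)) :
    (M * N).map (dirDeriv p v) =
      (MvPolynomial.eval p).mapMatrix M * N.map (dirDeriv p v) +
        M.map (dirDeriv p v) * (MvPolynomial.eval p).mapMatrix N := by
  ext i j
  simp [Matrix.mul_apply, dirDeriv_sum, dirDeriv_mul, Finset.sum_add_distrib]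

end dirDeriv

/-- The Jacobian row space is everything if no nonzero direction is annihilated by all the
differentials. -/
theorem jacobianRowSpace_eq_top {σ : Type*} [Fintype σ] {I : Ideal (MvPolynomial σ ℂ)}
    {p : σ → ℂ} (h : ∀ v : σ → ℂ, (∀ f ∈ I, dirDeriv p v f = 0) → v = 0) :
    jacobianRowSpace I p = ⊤ := by
  classical
  by_contra hne
  -- A functional killing a proper row space is, in coordinates, a direction killed by every
  -- differential.
  obtain ⟨φ, hφ, hle⟩ := Submodule.exists_le_ker_of_lt_top _ (lt_top_iff_ne_top.2 hne)
  apply hφ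
  have key : ∀ w : σ → ℂ, φ w = ∑ s, φ (Pi.single s 1) * w s := fun w => by
    rw [LinearMap.pi_apply_eq_sum_univ φ w]
    refine Finset.sum_congr rfl fun s _ => ?_
    rw [smul_eq_mul, mul_comm]
    congr 2
    ext t
    simp [Pi.single_apply, eq_comm]
  have hv := h (fun s => φ (Pi.single s 1)) fun f hf => by
    have hmem := hle (Submodule.subset_span ⟨f, hf, rfl⟩)
    rw [LinearMap.mem_ker, key] at hmem
    exact hmem
  refine LinearMap.ext fun w => ?_
  rw [key]
  exact Finset.sum_eq_zero fun s _ => by rw [show φ (Pi.single s 1) = 0 from congrFun hv s, zero_mul]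

/-- Makes the linear equations of the graph space into polynomial equations on the inverses:
non-edge entries of the adjugate vanish there. -/
theorem adjugate_nonsing_inv {n : ℕ} {K : Matrix (Fin n) (Fin n) ℂ} (hK : IsUnit K.det) :
    (K⁻¹).adjugate = (K⁻¹).det • K := by
  rw [← Matrix.mul_one (K⁻¹).adjugate, ← Matrix.nonsing_inv_mul K hK, ← Matrix.mul_assoc,
    Matrix.adjugate_mul, Matrix.smul_mul, Matrix.one_mul]

/-- The point `K⁻¹` is smooth and isolated in the intersection if the linearized problem at `K`
has no nonzero solution. -/
theorem isSmoothIsolated_inv {n : ℕ} {G : SimpleGraph (Fin n)} {K : Matrix (Fin n) (Fin n) ℂ}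
    (hK : K ∈ graphSpace G) (hdet : IsUnit K.det) (hdiag : ∀ i, K⁻¹ i i = 1)
    (hedge : ∀ i j, G.Adj i j → K⁻¹ i j = 0)
    (hker : ∀ H : Matrix (Fin n) (Fin n) ℂ, H.IsSymm → (∀ i, H i i = 0) →
      (∀ i j, G.Adj i j → H i j = 0) →
      (∀ i j, i ≠ j → ¬ G.Adj i j → (K * H * K) i j = 0) → H = 0) :
    IsSmoothIsolatedPointOfInter (reciprocalVariety (graphSpace G)) (identityFiber (graphSpace G))
      (symCoord K⁻¹) := by
  have hsymm : K⁻¹.IsSymm := by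
    rw [Matrix.IsSymm, Matrix.transpose_nonsing_inv, hK.1]
  have hX : ∀ f, f ∈ MvPolynomial.vanishingIdeal ℂ
      (symCoord '' {A | ∃ K ∈ graphSpace G, IsUnit K.det ∧ A = K⁻¹}) →
      f ∈ MvPolynomial.vanishingIdeal ℂ (reciprocalVariety (graphSpace G)) :=
    fun f hf x hx => hx f hf
  refine ⟨⟨fun f hf => hf _ ⟨K⁻¹, ⟨K, hK, hdet, rfl⟩, rfl⟩, K⁻¹, ⟨K⁻¹ - 1, ?_, by abel⟩, rfl⟩, ?_⟩
  · rw [mem_symPerp_graphSpace_iff]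
    refine ⟨?_, fun i => by simp [hdiag], fun i j hij => ?_⟩
    · rw [Matrix.IsSymm, Matrix.transpose_sub, hsymm, Matrix.transpose_one]
    · rw [Matrix.sub_apply, hedge i j hij, Matrix.one_apply_ne hij.ne, sub_zero]
  refine jacobianRowSpace_eq_top fun v hv => ?_
  have hH : ofCoord v = 0 := by
    refine hker _ (ofCoord_isSymm v) (fun i => ?_) (fun i j hij => ?_) fun i j hij hG => ?_
    · have := hv (MvPolynomial.X (symIdx i i) - 1) (Ideal.mem_sup_right ?_)
      · rw [sub_eq_add_neg, ← MvPolynomial.C_1, ← MvPolynomial.C_neg] at this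
        have hadd : dirDeriv (symCoord K⁻¹) v (MvPolynomial.X (symIdx i i) + MvPolynomial.C (-1)) =
            dirDeriv (symCoord K⁻¹) v (MvPolynomial.X (symIdx i i)) := by
          simp [dirDeriv]
        rw [hadd, dirDeriv_X] at this
        exact this
      · rintro _ ⟨_, ⟨X, hX, rfl⟩, rfl⟩
        rw [mem_symPerp_graphSpace_iff] at hX
        have hs : (1 + X).IsSymm := by
          rw [Matrix.IsSymm, Matrix.transpose_add, hX.1, Matrix.transpose_one]
        simp [symCoord_symIdx hs, hX.2.1]
    · have := hv (MvPolynomial.X (symIdx i j)) (Ideal.mem_sup_right ?_)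
      · rw [dirDeriv_X] at this
        exact this
      · rintro _ ⟨_, ⟨X, hX, rfl⟩, rfl⟩
        rw [mem_symPerp_graphSpace_iff] at hX
        have hs : (1 + X).IsSymm := by
          rw [Matrix.IsSymm, Matrix.transpose_add, hX.1, Matrix.transpose_one]
        simp [symCoord_symIdx hs, hX.2.2 i j hij, Matrix.one_apply_ne hij.ne]
    -- Differentiate adj(X) X = det(X) at K⁻¹ and multiply by K on the right: det(K⁻¹) KHK + d(adj)
    -- = d(det) K. At a non-edge both other terms vanish.
    · have hadj := hv ((genericSym n).adjugate i j) (Ideal.mem_sup_left (hX _ ?_))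
      · have e := dirDeriv_matrix_mul (symCoord K⁻¹) v (genericSym n).adjugate (genericSym n)
        have eX : (genericSym n).map (dirDeriv (symCoord K⁻¹) v) = ofCoord v := by
          ext a b
          simp [genericSym, ofCoord, dirDeriv_X]
        have e1 : ((genericSym n).det • (1 : Matrix (Fin n) (Fin n) (MvPolynomial (SymIdx n) ℂ))).map
            (dirDeriv (symCoord K⁻¹) v) =
            dirDeriv (symCoord K⁻¹) v (genericSym n).det • (1 : Matrix (Fin n) (Fin n) ℂ) := by
          ext a b
          by_cases hab : a = b
          · subst hab; simp
          · simp [Matrix.one_apply_ne hab, dirDeriv]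
        rw [Matrix.adjugate_mul, eval_adjugate_genericSym hsymm, genericSym_map_eval hsymm, eX,
          adjugate_nonsing_inv hdet, e1] at e
        have e' := congrArg (fun M => (M * K) i j) e
        simp only [Matrix.smul_mul, Matrix.one_mul, Matrix.add_mul, Matrix.mul_assoc,
          Matrix.nonsing_inv_mul K hdet, Matrix.mul_one, Matrix.add_apply, Matrix.smul_apply,
          Matrix.map_apply, smul_eq_mul, hadj, hK.2 i j hij hG, mul_zero, add_zero] at e'
        have hd : (K⁻¹).det ≠ 0 := by
          have := Matrix.isUnit_nonsing_inv_det K hdet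
          exact this.ne_zero
        rw [Matrix.mul_assoc]
        exact (mul_eq_zero.1 e'.symm).resolve_left hd
      · rintro _ ⟨_, ⟨K', hK', hdet', rfl⟩, rfl⟩
        have hs : K'⁻¹.IsSymm := by
          rw [Matrix.IsSymm, Matrix.transpose_nonsing_inv, hK'.1]
        have e := congrFun (congrFun (eval_adjugate_genericSym hs) i) j
        rw [adjugate_nonsing_inv hdet', Matrix.smul_apply, hK'.2 i j hij hG, smul_zero] at e
        simpa [MvPolynomial.aeval_eq_eval] using e
  funext s
  have := congrFun (congrFun hH s.1.1) s.1.2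
  simpa [ofCoord, symIdx_self] using this


/-! ### Corner matrices as quasi-periodic difference operators -/

theorem cycleGraph_adj_iff_dvd {n : ℕ} (hn : 3 ≤ n) (i j : Fin n) :
    (SimpleGraph.cycleGraph n).Adj i j ↔
      (n : ℤ) ∣ (j : ℤ) - i - 1 ∨ (n : ℤ) ∣ (j : ℤ) - i + 1 := by
  have key (a b : Fin n) : (a - b).val = 1 ↔ (n : ℤ) ∣ (a : ℤ) - b - 1 := by
    have hb := b.isLt
    have : (((a - b).val : ℕ) : ℤ) = ((a : ℤ) - b) % n := by
      rw [Fin.sub_def]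
      push_cast [Nat.cast_sub hb.le]
      rw [show (n : ℤ) - b + a = a - b + n by ring, Int.add_emod_right]
    rw [← Nat.cast_inj (R := ℤ), this, Nat.cast_one, Int.emod_eq_iff (by omega), dvd_sub_comm]
    exact ⟨fun h => h.2.2, fun h => ⟨by omega, by omega, h⟩⟩
  rw [SimpleGraph.cycleGraph_adj', key, key, or_comm]
  refine or_congr Iff.rfl ?_
  rw [← dvd_neg]
  ring_nf

/-- The corners are the steps i ∓ 1 wrapped around the cycle; for n ≥ 3 the five cases are disjoint,
so the entry is a sum of indicators. -/
theorem cornerMatrix_apply {n : ℕ} (hn : 3 ≤ n) (z σ : ℂ) (i j : Fin n) :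
    cornerMatrix n z (σ * z) i j =
      (if (j : ℤ) = i then 1 else 0) + z * (if (j : ℤ) = i - 1 then 1 else 0) +
        z * (if (j : ℤ) = i + 1 then 1 else 0) + σ * z * (if (j : ℤ) = i - 1 + n then 1 else 0) +
        σ * z * (if (j : ℤ) = i + 1 - n then 1 else 0) := by
  have hi := i.isLt
  have hj := j.isLt
  simp only [cornerMatrix, pathMatrix, Matrix.of_apply, Fin.ext_iff]
  split_ifs <;> first | omega | simp

theorem cornerMatrix_isSymm {n : ℕ} (hn : 3 ≤ n) (z σ : ℂ) :
    (cornerMatrix n z (σ * z)).IsSymm := by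
  ext i j
  have hi := i.isLt
  have hj := j.isLt
  simp only [cornerMatrix, pathMatrix, Matrix.of_apply, Fin.ext_iff, Matrix.transpose_apply]
  split_ifs <;> first | omega | rfl

theorem cornerMatrix_mem_cycleSpace {n : ℕ} (hn : 3 ≤ n) (z σ : ℂ) :
    cornerMatrix n z (σ * z) ∈ cycleSpace n := by
  refine ⟨cornerMatrix_isSymm hn z σ, fun i j hij hG => ?_⟩
  rw [cycleGraph_adj_iff_dvd hn, not_or] at hG
  have hi := i.isLt
  have hj := j.isLt
  rw [Ne, Fin.ext_iff] at hij
  have h1 : (j : ℤ) ≠ i - 1 := fun h => hG.2 ⟨0, by rw [h]; ring⟩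
  have h2 : (j : ℤ) ≠ i + 1 := fun h => hG.1 ⟨0, by rw [h]; ring⟩
  have h3 : (j : ℤ) ≠ i - 1 + n := fun h => hG.2 ⟨1, by rw [h]; ring⟩
  have h4 : (j : ℤ) ≠ i + 1 - n := fun h => hG.1 ⟨-1, by rw [h]; ring⟩
  rw [cornerMatrix_apply hn, if_neg h1, if_neg h2, if_neg h3, if_neg h4, if_neg (by omega)]
  simp

theorem sum_ite_fin_eq {n : ℕ} (w : ℤ → ℂ) (a : ℤ) :
    ∑ j : Fin n, (if (j : ℤ) = a then 1 else 0) * w j = if 0 ≤ a ∧ a < n then w a else 0 := by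
  split_ifs with h
  · rw [Finset.sum_eq_single ⟨a.toNat, by omega⟩]
    · simp [h.1]
    · intro b _ hb
      rw [Ne, Fin.ext_iff] at hb
      rw [if_neg, zero_mul]
      simp only at hb
      omega
    · simp
  · refine Finset.sum_eq_zero fun j _ => ?_
    have := j.isLt
    rw [if_neg (by omega), zero_mul]

/-- The action of `M_n^±(z)` on sequences satisfying the (anti)periodic boundary conditions. -/
theorem cornerMatrix_mulVec {n : ℕ} (hn : 3 ≤ n) (z σ : ℂ) (w : ℤ → ℂ)
    (h0 : w (-1) = σ * w (n - 1)) (h1 : w n = σ * w 0) (i : Fin n) :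
    ∑ j, cornerMatrix n z (σ * z) i j * w j = w i + z * (w (i - 1) + w (i + 1)) := by
  have hi := i.isLt
  simp only [cornerMatrix_apply hn, add_mul, mul_assoc, Finset.sum_add_distrib, ← Finset.mul_sum,
    sum_ite_fin_eq]
  rw [if_pos (by omega)]
  rcases eq_or_ne (i : ℕ) 0 with h | h
  · rw [if_neg (by omega), if_pos (by omega), if_pos (by omega), if_neg (by omega), h,
      show ((0 : ℕ) : ℤ) - 1 + n = n - 1 by push_cast; ring, show ((0 : ℕ) : ℤ) - 1 = -1 by norm_num,
      h0]
    ring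
  rcases eq_or_ne ((i : ℕ) + 1) n with h' | h'
  · rw [if_pos (by omega), if_neg (by omega), if_neg (by omega), if_pos (by omega),
      show (i : ℤ) + 1 - n = 0 by omega, show (i : ℤ) + 1 = n by omega, h1]
    ring
  · rw [if_pos (by omega), if_pos (by omega), if_neg (by omega), if_neg (by omega)]
    ring

/-! ### The explicit inverse -/

/-- The explicit inverse of `M_n^±(z)` at the special values of `z`. -/
noncomputable def sineMatrix (n : ℕ) (q : ℂ) : Matrix (Fin n) (Fin n) ℂ :=
  Matrix.of fun i j => -sineSeq q (|(i : ℤ) - j| - 1)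

section special

variable {n : ℕ} (hn : 4 ≤ n) {q z σ : ℂ} (hq : q ≠ 0) (hq2 : q ^ 2 ≠ 1)
  (hz : z * (q + q⁻¹) = -1) (hσ : σ * σ = 1) (hqn : q ^ (n - 2) = -σ)

include hn hq hσ hqn in
-- This reflection makes the two arcs joining i to j give values compatible with the sign σ.
theorem sineSeq_sub (k : ℤ) : sineSeq q ((n : ℤ) - 2 - k) = σ * sineSeq q k := by
  have h : q ^ ((n : ℤ) - 2) = -σ := by
    rw [← hqn, ← zpow_natCast, Nat.cast_sub (by omega)]; rfl
  rw [show (n : ℤ) - 2 - k = -k + (n - 2) by ring, sineSeq_add hq hσ h, sineSeq_neg]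
  ring

include hn hq hq2 hz hσ hqn in
-- Off the diagonal this is the recurrence for u; on it, the value -u(-1) = 1 supplies the unit
-- source, since both neighbours contribute u(0) = 0.
theorem cornerMatrix_mul_sineMatrix : cornerMatrix n z (σ * z) * sineMatrix n q = 1 := by
  have hu := sineSeq_sub hn hq hσ hqn
  ext i j
  have hi := i.isLt
  have hj := j.isLt
  rw [Matrix.mul_apply]
  have := cornerMatrix_mulVec (by omega : 3 ≤ n) z σ (fun k : ℤ => -sineSeq q (|k - j| - 1)) (by
    rw [abs_of_nonneg (by omega : (0 : ℤ) ≤ n - 1 - j), abs_of_nonpos (by omega : -1 - (j : ℤ) ≤ 0),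
      show (n : ℤ) - 1 - j - 1 = n - 2 - j by ring, hu,
      show -(-1 - (j : ℤ)) - 1 = j by ring]
    linear_combination sineSeq q j * hσ) (by
    rw [abs_of_nonneg (by omega : (0 : ℤ) ≤ n - j), abs_of_nonpos (by omega : 0 - (j : ℤ) ≤ 0),
      show (n : ℤ) - j - 1 = n - 2 - (-(0 - (j : ℤ)) - 1) by ring, hu]
    ring) i
  simp only [sineMatrix, Matrix.of_apply]
  rw [this]
  clear this
  rcases lt_trichotomy (i : ℤ) j with h | h | h
  · rw [Matrix.one_apply_ne (by rintro rfl; simp at h), abs_of_neg (by omega),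
      abs_of_neg (by omega), abs_of_nonpos (by omega)]
    have r := sineSeq_rec hq hz (j - i - 1)
    rw [show -((i : ℤ) - j) - 1 = j - i - 1 by ring,
      show -((i : ℤ) - 1 - j) - 1 = j - i - 1 + 1 by ring,
      show -((i : ℤ) + 1 - j) - 1 = j - i - 1 - 1 by ring]
    linear_combination -r
  · have h' : i = j := Fin.ext (by exact_mod_cast h)
    subst h'
    have un1 : sineSeq q (-1) = -1 := by rw [sineSeq_neg, sineSeq_one hq hq2]
    simp [un1, sineSeq_zero]
  · rw [Matrix.one_apply_ne (by rintro rfl; simp at h), abs_of_pos (by omega),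
      abs_of_nonneg (by omega), abs_of_pos (by omega)]
    have r := sineSeq_rec hq hz (i - j - 1)
    rw [show (i : ℤ) - 1 - j - 1 = i - j - 1 - 1 by ring,
      show (i : ℤ) + 1 - j - 1 = i - j - 1 + 1 by ring]
    linear_combination -r

include hq hq2 in
theorem sineMatrix_diag (i : Fin n) : sineMatrix n q i i = 1 := by
  have un1 : sineSeq q (-1) = -1 := by rw [sineSeq_neg, sineSeq_one hq hq2]
  simp [sineMatrix, un1]

include hn hq hσ hqn in
theorem sineMatrix_edge (i j : Fin n) (h : (SimpleGraph.cycleGraph n).Adj i j) :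
    sineMatrix n q i j = 0 := by
  have hi := i.isLt
  have hj := j.isLt
  have hu := sineSeq_sub hn hq hσ hqn 0
  rw [sineSeq_zero, mul_zero, sub_zero] at hu
  have habs : |(i : ℤ) - j| - 1 = 0 ∨ |(i : ℤ) - j| - 1 = n - 2 := by
    rw [cycleGraph_adj_iff_dvd (by omega)] at h
    rcases h with ⟨c, hc⟩ | ⟨c, hc⟩
    · have h1 : -2 < c := by nlinarith
      have h2 : c < 1 := by nlinarith
      obtain rfl | rfl : c = 0 ∨ c = -1 := by omega
      · left; rw [abs_of_neg (by omega)]; omega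
      · right; rw [abs_of_pos (by omega)]; omega
    · have h1 : -1 < c := by nlinarith
      have h2 : c < 2 := by nlinarith
      obtain rfl | rfl : c = 0 ∨ c = 1 := by omega
      · left; rw [abs_of_pos (by omega)]; omega
      · right; rw [abs_of_neg (by omega)]; omega
  rw [sineMatrix, Matrix.of_apply]
  rcases habs with e | e <;> rw [e]
  · rw [sineSeq_zero, neg_zero]
  · rw [hu, neg_zero]

end special


/-! ### Quasi-periodic lifts to the integers -/

/-- The residue of an integer, as an index. -/
def residue (n : ℕ) [NeZero n] (i : ℤ) : Fin n :=
  ⟨(i % n).toNat, by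
    have := Int.emod_lt_of_pos i (show (0 : ℤ) < n by exact_mod_cast NeZero.pos n)
    have := NeZero.pos n
    omega⟩

/-- The extension of a vector to a sequence on `ℤ` with `v (i + n) = σ v i`. -/
noncomputable def lift {n : ℕ} [NeZero n] (σ : ℂ) (v : Fin n → ℂ) (i : ℤ) : ℂ :=
  σ ^ (i / n) * v (residue n i)

section lift

variable {n : ℕ} [NeZero n] {σ : ℂ}

theorem coe_residue (i : ℤ) : ((residue n i : ℕ) : ℤ) = i % n := by
  simp only [residue]
  exact Int.toNat_of_nonneg (Int.emod_nonneg _ (by exact_mod_cast NeZero.ne n))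

theorem residue_add (i : ℤ) : residue n (i + n) = residue n i := by
  simp [residue]

theorem lift_add (hσ : σ ≠ 0) (v : Fin n → ℂ) (i : ℤ) : lift σ v (i + n) = σ * lift σ v i := by
  have hn : (n : ℤ) ≠ 0 := by exact_mod_cast NeZero.ne n
  rw [lift, lift, residue_add, Int.add_ediv_of_dvd_right (dvd_refl _), Int.ediv_self hn,
    zpow_add_one₀ hσ]
  ring

theorem lift_coe (v : Fin n → ℂ) (i : Fin n) : lift σ v i = v i := by
  have h1 : (i : ℤ) / n = 0 := Int.ediv_eq_zero_of_lt (by omega) (by have := i.isLt; omega)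
  have h2 : residue n i = i := by
    have := coe_residue (n := n) i
    rw [Int.emod_eq_of_lt (by omega) (by have := i.isLt; omega)] at this
    exact Fin.ext (by exact_mod_cast this)
  rw [lift, h1, h2, zpow_zero, one_mul]

/-- Two quasi-periodic sequences agree if they agree on one period. -/
theorem eq_of_quasiperiodic (f g : ℤ → ℂ) (hf : ∀ i, f (i + n) = σ * f i)
    (hg : ∀ i, g (i + n) = σ * g i) (hσ : σ ≠ 0) (h : ∀ i : Fin n, f i = g i) (i : ℤ) :
    f i = g i := by
  have key (m : ℤ) (a : ℤ) (ha : f a = g a) : f (a + n * m) = g (a + n * m) := by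
    induction m using Int.induction_on with
    | zero => simpa using ha
    | succ k ih => rw [mul_add, mul_one, ← add_assoc, hf, hg, ih]
    | pred k ih =>
      rw [show a + (n : ℤ) * -k = a + n * (-k - 1) + n by ring, hf, hg] at ih
      exact mul_left_cancel₀ hσ ih
  have := key (i / n) _ (h (residue n i))
  rwa [coe_residue, Int.emod_add_mul_ediv] at this

theorem lift_mulVec (hn : 3 ≤ n) (hσ2 : σ * σ = 1) (z : ℂ) (v : Fin n → ℂ) (i : ℤ) :
    lift σ (fun a => ∑ b, cornerMatrix n z (σ * z) a b * v b) i =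
      lift σ v i + z * (lift σ v (i - 1) + lift σ v (i + 1)) := by
  have hσ : σ ≠ 0 := by rintro rfl; simp at hσ2
  refine eq_of_quasiperiodic (n := n) _
    (fun i => lift σ v i + z * (lift σ v (i - 1) + lift σ v (i + 1)))
    (lift_add hσ _) (fun i => ?_) hσ (fun i => ?_) i
  · rw [add_sub_right_comm, add_right_comm, lift_add hσ, lift_add hσ, lift_add hσ]
    ring
  · rw [lift_coe, ← cornerMatrix_mulVec hn z σ (lift σ v)]
    · simp only [lift_coe]
    · have := lift_add hσ v (-1)
      rw [show (-1 : ℤ) + n = n - 1 by ring] at this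
      rw [this, ← mul_assoc, hσ2, one_mul]
    · simpa using lift_add hσ v 0

/-- The extension of a matrix to a kernel on `ℤ × ℤ`, quasi-periodic in both variables. -/
noncomputable def liftMatrix (σ : ℂ) (M : Matrix (Fin n) (Fin n) ℂ) (i j : ℤ) : ℂ :=
  lift σ (fun a => lift σ (M a) j) i

theorem liftMatrix_eq (M : Matrix (Fin n) (Fin n) ℂ) (i j : ℤ) :
    liftMatrix σ M i j = σ ^ (i / n) * (σ ^ (j / n) * M (residue n i) (residue n j)) := rfl

theorem liftMatrix_symm {M : Matrix (Fin n) (Fin n) ℂ} (hM : M.IsSymm) (i j : ℤ) :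
    liftMatrix σ M i j = liftMatrix σ M j i := by
  rw [liftMatrix_eq, liftMatrix_eq, hM.apply]
  ring

theorem liftMatrix_coe (M : Matrix (Fin n) (Fin n) ℂ) (i j : Fin n) :
    liftMatrix σ M i j = M i j := by
  simp only [liftMatrix, lift_coe]

theorem liftMatrix_mul_left (hn : 3 ≤ n) (hσ : σ * σ = 1) (z : ℂ)
    (M : Matrix (Fin n) (Fin n) ℂ) (i j : ℤ) :
    liftMatrix σ (cornerMatrix n z (σ * z) * M) i j =
      liftMatrix σ M i j + z * (liftMatrix σ M (i - 1) j + liftMatrix σ M (i + 1) j) := by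
  simp only [liftMatrix]
  rw [← lift_mulVec hn hσ]
  congr 1
  ext a
  simp only [lift, Matrix.mul_apply, Finset.mul_sum]
  refine Finset.sum_congr rfl fun b _ => by ring

theorem liftMatrix_mul_right (hn : 3 ≤ n) (hσ : σ * σ = 1) (z : ℂ)
    (M : Matrix (Fin n) (Fin n) ℂ) (i j : ℤ) :
    liftMatrix σ (M * cornerMatrix n z (σ * z)) i j =
      liftMatrix σ M i j + z * (liftMatrix σ M i (j - 1) + liftMatrix σ M i (j + 1)) := by
  have hT (N : Matrix (Fin n) (Fin n) ℂ) (a b : ℤ) :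
      liftMatrix σ N.transpose a b = liftMatrix σ N b a := by
    rw [liftMatrix_eq, liftMatrix_eq, Matrix.transpose_apply]
    ring
  rw [← hT, Matrix.transpose_mul, cornerMatrix_isSymm hn, liftMatrix_mul_left hn hσ, hT, hT, hT]

theorem dvd_residue_sub_iff (i j c : ℤ) :
    (n : ℤ) ∣ (residue n j : ℕ) - (residue n i : ℕ) + c ↔ (n : ℤ) ∣ j - i + c := by
  have e : j - i + c = ((residue n j : ℕ) - (residue n i : ℕ) + c) + n * (j / n - i / n) := by
    rw [coe_residue, coe_residue]
    linear_combination -Int.emod_add_mul_ediv j n + Int.emod_add_mul_ediv i n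
  rw [e, dvd_add_left (dvd_mul_right _ _)]

theorem residue_adj_iff (hn : 3 ≤ n) (i j : ℤ) :
    (SimpleGraph.cycleGraph n).Adj (residue n i) (residue n j) ↔
      (n : ℤ) ∣ j - i - 1 ∨ (n : ℤ) ∣ j - i + 1 := by
  rw [cycleGraph_adj_iff_dvd hn, ← dvd_residue_sub_iff i j 1, sub_eq_add_neg (j - i) 1,
    ← dvd_residue_sub_iff i j (-1), sub_eq_add_neg]

theorem eq_zero_of_linearized (hn : 4 ≤ n) {q z : ℂ} (hq : q ≠ 0) (hq2 : q ^ 2 ≠ 1)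
    (hz : z * (q + q⁻¹) = -1) (hσ : σ * σ = 1) (hqn : q ^ (n - 2) = -σ)
    (H : Matrix (Fin n) (Fin n) ℂ) (hH : H.IsSymm) (hd : ∀ i, H i i = 0)
    (he : ∀ i j, (SimpleGraph.cycleGraph n).Adj i j → H i j = 0)
    (hK : ∀ i j, i ≠ j → ¬ (SimpleGraph.cycleGraph n).Adj i j →
      (cornerMatrix n z (σ * z) * H * cornerMatrix n z (σ * z)) i j = 0) : H = 0 := by
  have hn3 : 3 ≤ n := by omega
  have hσ0 : σ ≠ 0 := by rintro rfl; simp at hσ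
  ext i j
  rw [← liftMatrix_coe (σ := σ) H i j]
  refine kernel_eq_zero hn hq hq2 hz hσ hqn (liftMatrix σ H)
    (liftMatrix σ (H * cornerMatrix n z (σ * z))) (liftMatrix_symm hH)
    (fun i j => lift_add hσ0 _ i) (fun i => ?_) (fun i => ?_)
    (liftMatrix_mul_right hn3 hσ z H) (fun i j h1 h2 => ?_) i j
  · rw [liftMatrix_eq, hd]; ring
  · rw [liftMatrix_eq, he _ _ ((residue_adj_iff hn3 _ _).2 (Or.inl (by simp)))]; ring
  · rw [← liftMatrix_mul_left hn3 hσ, ← Matrix.mul_assoc, liftMatrix_eq, hK]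
    · ring
    · intro h
      have h0 : (n : ℤ) ∣ j - i := by
        simpa using (dvd_residue_sub_iff (n := n) i j 0).1 (by simp [h])
      have := Int.le_of_dvd (by omega) h0
      omega
    · rw [residue_adj_iff hn3]
      rintro (h | h)
      · have := Int.le_of_dvd (by omega) h
        omega
      · have := Int.le_of_dvd (by omega) h
        omega

end lift

/-! ### Smoothness at the special parameters, with signs -/

/-- Both parts of the conclusion, at parameters `z = -1 / (q + q⁻¹)` with `q ^ (n - 2) = -σ`. -/
theorem cornerMatrix_isSmooth {n : ℕ} (hn : 4 ≤ n) {q z σ : ℂ} (hq : q ≠ 0) (hq2 : q ^ 2 ≠ 1)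
    (hz : z * (q + q⁻¹) = -1) (hσ : σ * σ = 1) (hqn : q ^ (n - 2) = -σ) :
    IsUnit (cornerMatrix n z (σ * z)).det ∧ ∀ D ∈ signMatrices n,
      IsSmoothInIntersection (D * (cornerMatrix n z (σ * z))⁻¹ * D) := by
  have : NeZero n := ⟨by omega⟩
  have hn3 : 3 ≤ n := by omega
  have hinv := cornerMatrix_mul_sineMatrix hn hq hq2 hz hσ hqn
  have hdet : IsUnit (cornerMatrix n z (σ * z)).det := Matrix.isUnit_det_of_right_inverse hinv
  have hmem := cornerMatrix_mem_cycleSpace hn3 z σ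
  have hlin := eq_zero_of_linearized hn hq hq2 hz hσ hqn
  refine ⟨hdet, ?_⟩
  rw [Matrix.inv_eq_right_inv hinv]
  generalize cornerMatrix n z (σ * z) = K at *
  rintro D ⟨d, hd, rfl⟩
  have hdd (i : Fin n) : d i * d i = 1 := by rcases hd i with h | h <;> rw [h] <;> norm_num
  have hd0 (i : Fin n) : d i ≠ 0 := fun h => by simpa [h] using hdd i
  have hDD : Matrix.diagonal d * Matrix.diagonal d = 1 := by
    rw [Matrix.diagonal_mul_diagonal, ← Matrix.diagonal_one]
    exact congrArg _ (funext hdd)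
  set D := Matrix.diagonal d with hD
  have hDa (M : Matrix (Fin n) (Fin n) ℂ) (i j : Fin n) : (D * M * D) i j = d i * M i j * d j := by
    rw [hD, Matrix.mul_diagonal, Matrix.diagonal_mul]
  have hconj (M : Matrix (Fin n) (Fin n) ℂ) (hM : M.IsSymm) : (D * M * D).IsSymm := by
    ext i j
    rw [Matrix.transpose_apply, hDa, hDa, hM.apply]
    ring
  have hinv' : (D * K * D) * (D * sineMatrix n q * D) = 1 := by
    calc (D * K * D) * (D * sineMatrix n q * D)
        = D * (K * (D * D) * sineMatrix n q) * D := by simp only [Matrix.mul_assoc]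
      _ = 1 := by rw [hDD, Matrix.mul_one, hinv, Matrix.mul_one, hDD]
  have hA := Matrix.inv_eq_right_inv hinv'
  have hdet' : IsUnit (D * K * D).det := Matrix.isUnit_det_of_right_inverse hinv'
  have hmem' : D * K * D ∈ cycleSpace n :=
    ⟨hconj K hmem.1, fun i j hij hG => by rw [hDa, hmem.2 i j hij hG]; ring⟩
  rw [← hA]
  refine ⟨by rw [Matrix.IsSymm, Matrix.transpose_nonsing_inv, hmem'.1],
    isSmoothIsolated_inv hmem' hdet' (fun i => ?_) (fun i j hij => ?_) fun H hH h0 h1 h2 => ?_⟩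
  · rw [hA, hDa, sineMatrix_diag hq hq2, mul_one, hdd]
  · rw [hA, hDa, sineMatrix_edge hn hq hσ hqn i j hij]; ring
  -- Since D² = 1, conjugating H by D turns the linearized problem at DKD into the one at K.
  · have key := hlin (D * H * D) (hconj H hH) (fun i => by rw [hDa, h0]; ring)
      (fun i j hij => by rw [hDa, h1 i j hij]; ring) (fun i j hij hG => by
        have h := h2 i j hij hG
        have e : D * K * D * H * (D * K * D) = D * (K * (D * H * D) * K) * D := by
          simp only [Matrix.mul_assoc]
        rw [e, hDa] at h
        simpa [hd0] using h)
    ext i j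
    have h := congrFun (congrFun key i) j
    rw [hDa] at h
    simpa [hd0] using h


/-! ### Translating the conditions on `P` into powers of q -/

theorem P_zero (z : ℂ) : P 0 z = 1 := by simp [P]

theorem P_one (z : ℂ) : P 1 z = 1 := by simp [P, pathMatrix]

theorem P_add_two (k : ℕ) (z : ℂ) : P (k + 2) z = P (k + 1) z - z ^ 2 * P k z := by
  have h1 : (pathMatrix (k + 2) z).submatrix Fin.succ (Fin.succAbove 0) = pathMatrix (k + 1) z := by
    ext i j
    simp [pathMatrix]
  have h2 : ((pathMatrix (k + 2) z).submatrix Fin.succ (Fin.succAbove 1)).det = z * P k z := by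
    rw [Matrix.det_succ_column_zero, Fin.sum_univ_succ, Finset.sum_eq_zero]
    · have e : ((pathMatrix (k + 2) z).submatrix Fin.succ (Fin.succAbove 1)).submatrix
          (Fin.succAbove 0) Fin.succ = pathMatrix k z := by
        ext i j
        have : (Fin.succAbove (1 : Fin (k + 2)) j.succ) = j.succ.succ := by
          rw [← Fin.succ_zero_eq_one, Fin.succ_succAbove_succ]; rfl
        simp [pathMatrix, this]
      rw [e, P]
      simp [pathMatrix]
    · intro i _
      simp [pathMatrix, Fin.ext_iff]
  rw [P, Matrix.det_succ_row_zero, Fin.sum_univ_succ, Fin.sum_univ_succ, Finset.sum_eq_zero]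
  · rw [h1, ← P]
    have : (Fin.succ 0 : Fin (k + 2)) = 1 := rfl
    rw [this, h2]
    simp [pathMatrix]
    ring
  · intro i _
    simp [pathMatrix, Fin.ext_iff]

theorem P_at_zero (k : ℕ) : P k 0 = 1 := by
  induction k using Nat.twoStepInduction with
  | zero => exact P_zero 0
  | one => exact P_one 0
  | more k _ h => rw [P_add_two, h]; ring

theorem sq_eq_quarter {q z : ℂ} (hq2 : q ^ 2 = 1) (hz : z * (q + q⁻¹) = -1) : z ^ 2 = 1 / 4 := by
  rw [inv_eq_of_mul_eq_one_left (by rw [← hq2]; ring : q * q = 1)] at hz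
  linear_combination (2 * z * q - 1) / 4 * hz - z ^ 2 * hq2

/-- The double-root case q = ±1, where `P_mul_sub_inv` is vacuous; used to exclude it. -/
theorem P_of_sq_eq_one {q z : ℂ} (hq2 : q ^ 2 = 1) (hz : z * (q + q⁻¹) = -1) (k : ℕ) :
    P k z = (k + 1) * (1 / 2) ^ k := by
  have hz2 := sq_eq_quarter hq2 hz
  induction k using Nat.twoStepInduction with
  | zero => simp [P_zero]
  | one => rw [P_one]; norm_num
  | more k h1 h2 =>
    rw [P_add_two, h1, h2, hz2]
    push_cast
    ring

theorem P_mul_sub_inv {q z : ℂ} (hq : q ≠ 0) (hz : z * (q + q⁻¹) = -1) (k : ℕ) :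
    P k z * (q - q⁻¹) = (-z) ^ k * (q ^ (k + 1) - q⁻¹ ^ (k + 1)) := by
  have hqq : q * q⁻¹ = 1 := mul_inv_cancel₀ hq
  generalize q⁻¹ = r at *
  induction k using Nat.twoStepInduction with
  | zero => simp [P_zero]
  | one =>
    rw [P_one]
    linear_combination (q - r) * hz
  | more k h1 h2 =>
    rw [P_add_two, sub_mul, h2, mul_assoc, h1]
    linear_combination (-z) ^ (k + 1) * (q ^ (k + 2) - r ^ (k + 2)) * hz -
      (-z) ^ (k + 1) * z * (q ^ (k + 1) - r ^ (k + 1)) * hqq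

/-- q is a root of zq² + q + z, found by the quadratic formula. -/
theorem exists_param {z : ℂ} (hz : z ≠ 0) : ∃ q : ℂ, q ≠ 0 ∧ z * (q + q⁻¹) = -1 := by
  obtain ⟨s, hs⟩ := IsAlgClosed.exists_pow_nat_eq (1 - 4 * z ^ 2) (show 0 < 2 by norm_num)
  have h0 : s - 1 ≠ 0 := by
    intro h
    have : s = 1 := by linear_combination h
    rw [this] at hs
    have : z ^ 2 = 0 := by linear_combination hs / 4
    exact hz (by simpa using this)
  refine ⟨(s - 1) / (2 * z), div_ne_zero h0 (by simpa using hz), ?_⟩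
  field_simp
  linear_combination hs

theorem param_odd_plus {q z : ℂ} (hq : q ≠ 0) (hz : z * (q + q⁻¹) = -1) {k : ℕ}
    (h : P (k + 1) z + z * P k z = 0) : q ^ 2 ≠ 1 ∧ q ^ (2 * k + 3) = -1 := by
  have hz0 : z ≠ 0 := by rintro rfl; simp at hz
  have hq2 : q ^ 2 ≠ 1 := by
    intro hq2
    have hz2 := sq_eq_quarter hq2 hz
    rw [P_of_sq_eq_one hq2 hz, P_of_sq_eq_one hq2 hz] at h
    have h2 : (1 / 2 : ℂ) ^ k ≠ 0 := pow_ne_zero _ (by norm_num)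
    have h3 : (k : ℂ) + 2 + 2 * z * (k + 1) = 0 := by
      refine (mul_eq_zero.1 (?_ : (1 / 2 : ℂ) ^ k * _ = 0)).resolve_left h2
      push_cast at h
      linear_combination 2 * h
    -- As 4z² = 1, squaring `h3` gives (k+2)² = (k+1)².
    have h4 : (2 * k + 3 : ℂ) = 0 := by
      linear_combination (k + 2 - 2 * z * (k + 1)) * h3 + 4 * (k + 1) ^ 2 * hz2
    exact absurd h4 (by exact_mod_cast (by omega : 2 * k + 3 ≠ 0))
  refine ⟨hq2, ?_⟩
  have e1 := P_mul_sub_inv hq hz (k + 1)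
  have e2 := P_mul_sub_inv hq hz k
  have e : (-z) ^ (k + 1) * (q ^ (k + 2) - q⁻¹ ^ (k + 2) - (q ^ (k + 1) - q⁻¹ ^ (k + 1))) = 0 := by
    linear_combination (q - q⁻¹) * h - e1 - z * e2
  have e' := (mul_eq_zero.1 e).resolve_left (pow_ne_zero _ (neg_ne_zero.2 hz0))
  have hr : q ^ (k + 1) * q⁻¹ ^ (k + 1) = 1 := by rw [← mul_pow, mul_inv_cancel₀ hq, one_pow]
  have hqq : q * q⁻¹ = 1 := mul_inv_cancel₀ hq
  have h1 : q - 1 ≠ 0 := fun h1 => hq2 (by linear_combination (q + 1) * h1)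
  -- Clearing q⁻¹ with q^(k+2) gives q^(2k+4) - q^(2k+3) + q - 1, which factors.
  have : (q - 1) * (q ^ (2 * k + 3) + 1) = 0 := by
    linear_combination q ^ (k + 2) * e' + (q * q⁻¹ - q) * hr + hqq
  linear_combination (mul_eq_zero.1 this).resolve_left h1

theorem param_even_plus {q z : ℂ} (hq : q ≠ 0) (hz : z * (q + q⁻¹) = -1) {k : ℕ}
    (h : P (k + 2) z - z ^ 2 * P k z = 0) : q ^ 2 ≠ 1 ∧ q ^ (2 * k + 4) = -1 := by
  have hz0 : z ≠ 0 := by rintro rfl; simp at hz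
  have hq2 : q ^ 2 ≠ 1 := by
    intro hq2
    have hz2 := sq_eq_quarter hq2 hz
    rw [P_of_sq_eq_one hq2 hz, P_of_sq_eq_one hq2 hz, hz2] at h
    have h2 : (1 / 2 : ℂ) ^ k ≠ 0 := pow_ne_zero _ (by norm_num)
    apply h2
    push_cast at h
    linear_combination 2 * h
  refine ⟨hq2, ?_⟩
  have e1 := P_mul_sub_inv hq hz (k + 2)
  have e2 := P_mul_sub_inv hq hz k
  have e : (-z) ^ (k + 2) * (q ^ (k + 3) - q⁻¹ ^ (k + 3) - (q ^ (k + 1) - q⁻¹ ^ (k + 1))) = 0 := by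
    linear_combination (q - q⁻¹) * h - e1 + z ^ 2 * e2
  have e' := (mul_eq_zero.1 e).resolve_left (pow_ne_zero _ (neg_ne_zero.2 hz0))
  have hr : q ^ (k + 1) * q⁻¹ ^ (k + 1) = 1 := by rw [← mul_pow, mul_inv_cancel₀ hq, one_pow]
  have hqq : q ^ 2 * q⁻¹ ^ 2 = 1 := by rw [← mul_pow, mul_inv_cancel₀ hq, one_pow]
  have : (q ^ 2 - 1) * (q ^ (2 * k + 4) + 1) = 0 := by
    linear_combination q ^ (k + 3) * e' + (q ^ 2 * q⁻¹ ^ 2 - q ^ 2) * hr + hqq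
  linear_combination (mul_eq_zero.1 this).resolve_left (sub_ne_zero.2 hq2)

theorem param_minus {q z : ℂ} (hq : q ≠ 0) (hz : z * (q + q⁻¹) = -1) {k : ℕ}
    (h : P k z = 0) : q ^ 2 ≠ 1 ∧ q ^ (2 * k + 2) = 1 := by
  have hz0 : z ≠ 0 := by rintro rfl; simp at hz
  have hq2 : q ^ 2 ≠ 1 := by
    intro hq2
    rw [P_of_sq_eq_one hq2 hz] at h
    have h2 : (1 / 2 : ℂ) ^ k ≠ 0 := pow_ne_zero _ (by norm_num)
    exact absurd ((mul_eq_zero.1 h).resolve_right h2) (Nat.cast_add_one_ne_zero k)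
  refine ⟨hq2, ?_⟩
  have e := P_mul_sub_inv hq hz k
  rw [h, zero_mul] at e
  have e' := (mul_eq_zero.1 e.symm).resolve_left (pow_ne_zero _ (neg_ne_zero.2 hz0))
  have hr : q ^ (k + 1) * q⁻¹ ^ (k + 1) = 1 := by rw [← mul_pow, mul_inv_cancel₀ hq, one_pow]
  linear_combination q ^ (k + 1) * e' + hr

end CycleModel

theorem proposition3p6 :
    (∀ (m : ℕ), 2 ≤ m → ∀ (z : ℂ),
      CycleModel.P (m - 1) z + z * CycleModel.P (m - 2) z = 0 →
      IsUnit (CycleModel.Mplus (2 * m + 1) z).det ∧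
      ∀ D ∈ CycleModel.signMatrices (2 * m + 1),
        CycleModel.IsSmoothInIntersection (D * (CycleModel.Mplus (2 * m + 1) z)⁻¹ * D)) ∧
    (∀ (m : ℕ), 3 ≤ m → ∀ (x : ℂ),
      CycleModel.P (m - 1) x - x ^ 2 * CycleModel.P (m - 3) x = 0 →
      IsUnit (CycleModel.Mplus (2 * m) x).det ∧
      ∀ D ∈ CycleModel.signMatrices (2 * m),
        CycleModel.IsSmoothInIntersection (D * (CycleModel.Mplus (2 * m) x)⁻¹ * D)) ∧
    (∀ (m : ℕ), 2 ≤ m → ∀ (x : ℂ),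
      CycleModel.P (m - 2) x = 0 →
      IsUnit (CycleModel.Mminus (2 * m) x).det ∧
      ∀ D ∈ CycleModel.signMatrices (2 * m),
        CycleModel.IsSmoothInIntersection (D * (CycleModel.Mminus (2 * m) x)⁻¹ * D)) := by
  refine ⟨fun m hm z h => ?_, fun m hm z h => ?_, fun m hm z h => ?_⟩
  -- Every `P k 0` is 1, so at z = 0 the hypothesis would read 1 = 0.
  · have hz0 : z ≠ 0 := by rintro rfl; simp [CycleModel.P_at_zero] at h
    obtain ⟨q, hq, hz⟩ := CycleModel.exists_param hz0
    obtain ⟨k, rfl⟩ : ∃ k, m = k + 2 := ⟨m - 2, by omega⟩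
    obtain ⟨hq2, hqn⟩ := CycleModel.param_odd_plus hq hz (k := k) h
    have := CycleModel.cornerMatrix_isSmooth (n := 2 * (k + 2) + 1) (by omega) hq hq2 hz
      (one_mul 1) (by rw [← hqn]; congr 1)
    rwa [one_mul] at this
  · have hz0 : z ≠ 0 := by rintro rfl; simp [CycleModel.P_at_zero] at h
    obtain ⟨q, hq, hz⟩ := CycleModel.exists_param hz0
    obtain ⟨k, rfl⟩ : ∃ k, m = k + 3 := ⟨m - 3, by omega⟩
    obtain ⟨hq2, hqn⟩ := CycleModel.param_even_plus hq hz (k := k) h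
    have := CycleModel.cornerMatrix_isSmooth (n := 2 * (k + 3)) (by omega) hq hq2 hz
      (one_mul 1) (by rw [← hqn]; congr 1)
    rwa [one_mul] at this
  · have hz0 : z ≠ 0 := by rintro rfl; simp [CycleModel.P_at_zero] at h
    obtain ⟨q, hq, hz⟩ := CycleModel.exists_param hz0
    obtain ⟨k, rfl⟩ : ∃ k, m = k + 2 := ⟨m - 2, by omega⟩
    obtain ⟨hq2, hqn⟩ := CycleModel.param_minus hq hz (k := k) h
    have := CycleModel.cornerMatrix_isSmooth (n := 2 * (k + 2)) (σ := -1) (by omega) hq hq2 hz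
      (by ring) (by rw [neg_neg, ← hqn]; congr 1)
    rwa [neg_one_mul] at this
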